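/- Let $\sigma\ge 0$ and let $f,f_n:\mathbb{R}\to\mathbb{R}$ ($n\in\mathbb{N}$) be Lebesgue measurable functions in $L^\infty_{\mathrm{loc}}(\mathbb{R})$ that are $1$-periodic in the sense that $f(t+1)=f(t)$ and $f_n(t+1)=f_n(t)$ for a.e. $t$. Suppose that there is $\varsigma>0$ with $f(t)-\sigma>\varsigma$ for a.e. $t$. For the leaky integrate-and-fire system $\dot x=-\sigma x+f(t)$ with reset value $0$ and threshold $1$, the firing map is $$\Phi(t)=\inf\Big\{t_*>t:\ e^{\sigma t}\le\int_t^{t_*}[f(u)-\sigma]e^{\sigma u}\,du\Big\},\qquad t\in\mathbb{R},$$ and $\Phi_n$ is the firing map defined in the same way from $f_n$. Suppose that $\Phi$ and all $\Phi_n$ have irrational rotation numbers, i.e. there are irrational $\varrho,\varrho_n$ with $\lim_{k\to\infty}\Phi^k(t)/k=\varrho$ and $\lim_{k\to\infty}\Phi_n^k(t)/k=\varrho_n$ for every $t\in\mathbb{R}$. Suppose finally that $f_n\to f$ in $L^\infty_{\mathrm{loc}}(\mathbb{R})$, i.e. with respect to the metric $$d(f,g)=\sum_{k=1}^\infty 2^{-k}\frac{\|f-g\|_{L^\infty([-k,k])}}{1+\|f-g\|_{L^\infty([-k,k])}}.$$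 Then the circle map $\varphi=\Phi \bmod 1$ on $\mathbb{R}/\mathbb{Z}$ has a unique invariant Borel probability measure $\mu$, and for all sufficiently large $n$ so does $\varphi_n=\Phi_n\bmod 1$, with measure $\mu^{(n)}$. Consequently, the interspike-interval distributions $$\mu_{\mathrm{ISI}}(A)=\mu(\{t\in[0,1):\Phi(t)-t\in A\}),\qquad \mu^{(n)}_{\mathrm{ISI}}(A)=\mu^{(n)}(\{t\in[0,1):\Phi_n(t)-t\in A\})$$ ($A\subset\mathbb{R}$ Borel) are well defined, the latter for all sufficiently large $n$. Moreover, $\mu^{(n)}_{\mathrm{ISI}}$ converges weakly to $\mu_{\mathrm{ISI}}$ as $n\to\infty$, i.e. $\int g\,d\mu^{(n)}_{\mathrm{ISI}}\to\int g\,d\mu_{\mathrm{ISI}}$ for every bounded continuous $g:\mathbb{R}\to\mathbb{R}$. -/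

import Mathlib

open MeasureTheory Filter Topology
open scoped BoundedContinuousFunction

namespace IntegrateFire

/-- `f ∈ L^∞_loc(ℝ)`: Lebesgue measurable and essentially bounded on every compact set. -/
def MemLinftyLoc (f : ℝ → ℝ) : Prop :=
  ∀ K : Set ℝ, IsCompact K → MemLp f ⊤ (volume.restrict K)

/-- The seminorm `ess sup_{[-k,k]} |f|`. -/
noncomputable def essSupSeminorm (k : ℕ) (f : ℝ → ℝ) : ℝ :=
  (eLpNorm f ⊤ (volume.restrict (Set.Icc (-(k : ℝ)) k))).toReal

/-- The metric of the Fréchet space `L^∞_loc(ℝ)`: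
`∑_{k ≥ 1} 2^{-k} ‖f - g‖_k / (1 + ‖f - g‖_k)` with `‖·‖_k = ess sup_{[-k,k]} |·|`. -/
noncomputable def linftyLocDist (f g : ℝ → ℝ) : ℝ :=
  ∑' j : ℕ, (1 / 2 ^ (j + 1)) *
    (essSupSeminorm (j + 1) (fun t => f t - g t) /
      (1 + essSupSeminorm (j + 1) (fun t => f t - g t)))

/-- Periodicity with period `1`, in the almost everywhere sense. -/
def AEPeriodicOne (f : ℝ → ℝ) : Prop :=
  ∀ᵐ t ∂(volume : Measure ℝ), f (t + 1) = f t

/-- The firing map of `x' = -σ x + f(t)` with reset `0` and threshold `1`. -/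
noncomputable def firingMap (σ : ℝ) (f : ℝ → ℝ) (t : ℝ) : ℝ :=
  sInf {s : ℝ | t < s ∧
    Real.exp (σ * t) ≤ ∫ u in t..s, (f u - σ) * Real.exp (σ * u)}

/-- `ρ` is the rotation number of `Φ : ℝ → ℝ`: `Φⁿ(t)/n → ρ` for every `t`. -/
def HasRotationNumber (Φ : ℝ → ℝ) (ρ : ℝ) : Prop :=
  ∀ t : ℝ, Tendsto (fun n : ℕ => Φ^[n] t / n) atTop (𝓝 ρ)

/-- The representative in `[0,1)` of a point of the circle `ℝ/ℤ`. -/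
noncomputable def rep (z : UnitAddCircle) : ℝ :=
  (AddCircle.equivIco (1 : ℝ) 0 z : ℝ)

/-- The circle map `Φ mod 1` on `ℝ/ℤ`. -/
noncomputable def phaseMap (Φ : ℝ → ℝ) (z : UnitAddCircle) : UnitAddCircle :=
  ((Φ (rep z) : ℝ) : UnitAddCircle)

/-- The displacement `Ψ(t) = Φ(t) - t`, `t ∈ [0,1)`, as a function on the circle `ℝ/ℤ`. -/
noncomputable def displacement (Φ : ℝ → ℝ) (z : UnitAddCircle) : ℝ :=
  Φ (rep z) - rep z

theorem rep_coe (t : ℝ) : rep (t : UnitAddCircle) = t - ⌊t⌋ := by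
  rw [rep, AddCircle.coe_equivIco_mk_apply, div_one, mul_one, Int.self_sub_floor]

theorem phaseMap_coe {Φ : ℝ → ℝ} (hΦ : ∀ t, Φ (t + 1) = Φ t + 1) (t : ℝ) :
    phaseMap Φ (t : UnitAddCircle) = ((Φ t : ℝ) : UnitAddCircle) := by
  have hper : Function.Periodic (fun s => Φ s - s) 1 := fun s => by
    simp only [hΦ]; ring
  have h := hper.sub_int_mul_eq (x := t) ⌊t⌋
  simp only [mul_one] at h
  rw [phaseMap, rep_coe, show Φ (t - ⌊t⌋) = Φ t - ⌊t⌋ by linarith, AddCircle.coe_sub]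
  have : (((⌊t⌋ : ℤ) : ℝ) : UnitAddCircle) = 0 := by
    rw [AddCircle.coe_eq_zero_iff]; exact ⟨⌊t⌋, by simp⟩
  rw [this, sub_zero]

theorem displacement_coe {Φ : ℝ → ℝ} (hΦ : ∀ t, Φ (t + 1) = Φ t + 1) (t : ℝ) :
    displacement Φ (t : UnitAddCircle) = Φ t - t := by
  have hper : Function.Periodic (fun s => Φ s - s) 1 := fun s => by
    simp only [hΦ]; ring
  have h := hper.sub_int_mul_eq (x := t) ⌊t⌋
  simp only [mul_one] at h
  rw [displacement, rep_coe, h]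

/-- `μ` is a Borel probability measure on the circle invariant under `φ`. -/
def IsInvariantProb (φ : UnitAddCircle → UnitAddCircle) (μ : Measure UnitAddCircle) : Prop :=
  IsProbabilityMeasure μ ∧ MeasurePreserving φ μ μ

open Classical in
/-- The unique `φ`-invariant Borel probability measure (by convention `0` if there is no such
measure or more than one). -/
noncomputable def invariantMeasure (φ : UnitAddCircle → UnitAddCircle) : Measure UnitAddCircle :=
  if h : ∃! μ : Measure UnitAddCircle, IsInvariantProb φ μ then h.choose else 0

/-- The interspike-interval distribution: the image of the unique invariant probability measure
of the firing phase map under the displacement function. -/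
noncomputable def isiDistribution (σ : ℝ) (f : ℝ → ℝ) : Measure ℝ :=
  (invariantMeasure (phaseMap (firingMap σ f))).map (displacement (firingMap σ f))

/-- Weak convergence of a sequence of finite Borel measures on `ℝ`. -/
def WeaklyConverges (ν : ℕ → Measure ℝ) (ν₀ : Measure ℝ) : Prop :=
  ∀ g : ℝ →ᵇ ℝ, Tendsto (fun n => ∫ x, g x ∂(ν n)) atTop (𝓝 (∫ x, g x ∂ν₀))

end IntegrateFire

open IntegrateFire

namespace IntegrateFire

/-! Since `f - σ` is bounded below by a positive constant, the primitive `G` of `(f - σ) * exp (σ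
u)` is strictly increasing and the firing map solves `G (Φ t) = G t + exp (σ t)`. Hence `Φ` is a
continuous, strictly increasing lift of a degree one circle homeomorphism.

For such a lift with irrational translation number, the distribution function of an invariant
measure semiconjugates it to a rotation. Density of `ℤρ + ℤ` makes this semiconjugacy unique up to a
constant (`semiconj_sub_le`), which gives uniqueness of the measure; existence comes from
transporting Lebesgue measure from the rotation.

Convergence in `L^∞_loc` and periodicity give uniform closeness of the inputs on all of `ℝ`, and `Φ`
depends on the input in a Lipschitz way (`abs_firingMap_sub_firingMap_le`). By compactness every
weak cluster point of the `μ⁽ⁿ⁾` is invariant under the limit map, hence equals `μ`. Uniform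
convergence of the continuous displacements carries this over to the interspike-interval
distributions. -/

/-! ### Circle maps induced by degree one lifts -/

theorem rep_mem (z : UnitAddCircle) : rep z ∈ Set.Ico (0 : ℝ) 1 := by
  have h := (AddCircle.equivIco (1 : ℝ) 0 z).2
  exact ⟨h.1, h.2.trans_eq (zero_add 1)⟩

theorem coe_rep (z : UnitAddCircle) : ((rep z : ℝ) : UnitAddCircle) = z :=
  (AddCircle.equivIco (1 : ℝ) 0).symm_apply_apply z

theorem measurable_rep : Measurable rep :=
  measurable_subtype_coe.comp (AddCircle.measurableEquivIco (1 : ℝ) 0).measurable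

theorem measurable_phaseMap {Φ : ℝ → ℝ} (hΦ : Measurable Φ) : Measurable (phaseMap Φ) :=
  AddCircle.measurable_mk'.comp (hΦ.comp measurable_rep)

theorem continuous_phaseMap (F : CircleDeg1Lift) (hF : Continuous F) :
    Continuous (phaseMap F) := by
  refine (QuotientAddGroup.isQuotientMap_mk
    (N := AddSubgroup.zmultiples (1 : ℝ))).continuous_iff.2 ?_
  have : phaseMap F ∘ ((↑) : ℝ → UnitAddCircle) = ((↑) : ℝ → UnitAddCircle) ∘ F :=
    funext fun t => phaseMap_coe F.map_add_one t
  exact this ▸ (AddCircle.continuous_mk' 1).comp hF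

theorem continuous_displacement (F : CircleDeg1Lift) (hF : Continuous F) :
    Continuous (displacement F) := by
  refine (QuotientAddGroup.isQuotientMap_mk
    (N := AddSubgroup.zmultiples (1 : ℝ))).continuous_iff.2 ?_
  have : displacement F ∘ ((↑) : ℝ → UnitAddCircle) = fun t => F t - t :=
    funext fun t => displacement_coe F.map_add_one t
  exact this ▸ hF.sub continuous_id

theorem exists_int_mul_add_int_btwn {ρ : ℝ} (hρ : Irrational ρ) {a b : ℝ} (hab : a < b) :
    ∃ k m : ℤ, a < k * ρ + m ∧ (k * ρ + m : ℝ) < b := by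
  have hd : Dense (AddSubgroup.closure {ρ, 1} : Set ℝ) := by
    rw [dense_addSubgroupClosure_pair_iff]; simpa using hρ
  obtain ⟨x, hx, hxab⟩ := hd.exists_between hab
  obtain ⟨k, m, h⟩ := AddSubgroup.mem_closure_pair.1 hx
  refine ⟨k, m, ?_⟩
  have : (k * ρ + m : ℝ) = x := by simpa using h
  rw [this]; exact hxab

theorem bijective_of_continuous_of_strictMono (F : CircleDeg1Lift) (hc : Continuous F)
    (hm : StrictMono F) : Function.Bijective F :=
  ⟨hm.injective, hc.surjective F.tendsto_atTop F.tendsto_atBot⟩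

/-! ### Semiconjugacies to a rotation -/

theorem semiconj_iterate_add_int (F H : CircleDeg1Lift) {ρ : ℝ} (hH : ∀ t, H (F t) = H t + ρ)
    (k : ℕ) (m : ℤ) (t : ℝ) : H (F^[k] t + m) = H t + k * ρ + m := by
  rw [H.map_add_int]
  congr 1
  induction k with
  | zero => simp
  | succ k ih => rw [Function.iterate_succ_apply', hH, ih]; push_cast; ring

/-- If the inequality failed, some `k * ρ + m` would lie strictly between the two increments. By
monotonicity of `H₁` and `H₂`, the point `F^[k] s + m` would then be both to the right and to the
left of `t`. -/
theorem semiconj_sub_le (F H₁ H₂ : CircleDeg1Lift) {ρ : ℝ} (hρ : Irrational ρ)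
    (h₁ : ∀ t, H₁ (F t) = H₁ t + ρ) (h₂ : ∀ t, H₂ (F t) = H₂ t + ρ) (s t : ℝ) :
    H₂ t - H₂ s ≤ H₁ t - H₁ s := by
  by_contra! hlt
  obtain ⟨k, m, hk₁, hk₂⟩ := exists_int_mul_add_int_btwn hρ hlt
  obtain ⟨j, rfl | rfl⟩ := k.eq_nat_or_neg
  · have e₁ := semiconj_iterate_add_int F H₁ h₁ j m s
    have e₂ := semiconj_iterate_add_int F H₂ h₂ j m s
    push_cast at hk₁ hk₂
    have l₁ : t < F^[j] s + m := H₁.monotone.reflect_lt (by linarith)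
    have l₂ : F^[j] s + m < t := H₂.monotone.reflect_lt (by linarith)
    exact lt_asymm l₁ l₂
  -- `F` need not be invertible here, so for negative `k` the orbit of `t` is moved forward and
  -- compared with `s`.
  · have e₁ := semiconj_iterate_add_int F H₁ h₁ j (-m) t
    have e₂ := semiconj_iterate_add_int F H₂ h₂ j (-m) t
    push_cast at hk₁ hk₂ e₁ e₂
    have l₁ : F^[j] t + (-m : ℝ) < s := H₁.monotone.reflect_lt (by linarith)
    have l₂ : s < F^[j] t + (-m : ℝ) := H₂.monotone.reflect_lt (by linarith)
    exact lt_asymm l₁ l₂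

/-! ### The lifted distribution function of a measure on the circle -/

theorem integrable_ceil_sub_rep (ν : Measure UnitAddCircle) [IsProbabilityMeasure ν] (t : ℝ) :
    Integrable (fun z => (⌈t - rep z⌉ : ℝ)) ν := by
  refine Integrable.of_bound (C := |t| + 2) ?_ (ae_of_all _ fun z => ?_)
  · exact ((measurable_from_top (f := ((↑) : ℤ → ℝ))).comp
      (Int.measurable_ceil.comp (measurable_const.sub measurable_rep))).aestronglyMeasurable
  · have h := rep_mem z
    have h₁ := Int.le_ceil (t - rep z)
    have h₂ := Int.ceil_lt_add_one (t - rep z)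
    have := abs_le.1 (le_refl |t|)
    rw [Real.norm_eq_abs, abs_le]
    constructor <;> linarith [h.1, h.2]

/-- The lift to `ℝ` of the distribution function of a probability measure on the circle:
the integral counts the points of `[0, t)` that lie over `z`. -/
noncomputable def liftedCdf (ν : Measure UnitAddCircle) [IsProbabilityMeasure ν] :
    CircleDeg1Lift where
  toFun t := ∫ z, (⌈t - rep z⌉ : ℝ) ∂ν
  monotone' s t hst := integral_mono (integrable_ceil_sub_rep ν s) (integrable_ceil_sub_rep ν t)
    fun z => by
      have : ⌈s - rep z⌉ ≤ ⌈t - rep z⌉ := Int.ceil_mono (by linarith)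
      exact Int.cast_le.2 this
  map_add_one' t := by
    have h (z : UnitAddCircle) : (⌈t + 1 - rep z⌉ : ℝ) = ⌈t - rep z⌉ + 1 := by
      rw [show t + 1 - rep z = t - rep z + 1 by ring, Int.ceil_add_one]; push_cast; rfl
    simp only [h]
    rw [integral_add (integrable_ceil_sub_rep ν t) (integrable_const _)]
    simp

theorem liftedCdf_apply (ν : Measure UnitAddCircle) [IsProbabilityMeasure ν] (t : ℝ) :
    liftedCdf ν t = ∫ z, (⌈t - rep z⌉ : ℝ) ∂ν := rfl

theorem liftedCdf_eq_measureReal (ν : Measure UnitAddCircle) [IsProbabilityMeasure ν] {t : ℝ}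
    (ht : t ∈ Set.Icc (0 : ℝ) 1) : liftedCdf ν t = ν.real {z | rep z < t} := by
  have hms : MeasurableSet {z | rep z < t} := measurable_rep measurableSet_Iio
  rw [liftedCdf_apply, ← integral_indicator_one hms]
  congr 1 with z
  have h := rep_mem z
  by_cases hz : rep z < t
  · have : ⌈t - rep z⌉ = 1 := Int.ceil_eq_iff.2 ⟨by push_cast; linarith, by push_cast; linarith [h.1, ht.2]⟩
    simp [this, hz]
  · have : ⌈t - rep z⌉ = 0 := Int.ceil_eq_iff.2 ⟨by push_cast; linarith [h.2, ht.1], by push_cast; linarith⟩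
    simp [this, hz]

theorem liftedCdf_zero (ν : Measure UnitAddCircle) [IsProbabilityMeasure ν] :
    liftedCdf ν 0 = 0 := by
  rw [liftedCdf_eq_measureReal ν ⟨le_rfl, zero_le_one⟩]
  have : {z | rep z < 0} = ∅ := Set.eq_empty_of_forall_notMem fun z hz =>
    absurd hz (not_lt.2 (rep_mem z).1)
  simp [this]

/-- The values on `[0, 1]` determine the image under `rep` on half-lines, and projecting that image
back to the circle recovers the measure. -/
theorem ext_of_liftedCdf {ν₁ ν₂ : Measure UnitAddCircle} [IsProbabilityMeasure ν₁]
    [IsProbabilityMeasure ν₂] (h : ∀ t, liftedCdf ν₁ t = liftedCdf ν₂ t) : ν₁ = ν₂ := by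
  have hmap : ν₁.map rep = ν₂.map rep := by
    have := Measure.isProbabilityMeasure_map (μ := ν₁) measurable_rep.aemeasurable
    have := Measure.isProbabilityMeasure_map (μ := ν₂) measurable_rep.aemeasurable
    refine Measure.ext_of_Ici _ _ fun t => ?_
    rw [← measureReal_eq_measureReal_iff, ← Set.compl_Iio,
      probReal_compl_eq_one_sub measurableSet_Iio, probReal_compl_eq_one_sub measurableSet_Iio,
      map_measureReal_apply measurable_rep measurableSet_Iio,
      map_measureReal_apply measurable_rep measurableSet_Iio]
    congr 1
    change ν₁.real {z | rep z < t} = ν₂.real {z | rep z < t}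
    rcases lt_trichotomy t 0 with ht | ht | ht
    · have : {z | rep z < t} = ∅ := Set.eq_empty_of_forall_notMem fun z hz =>
        absurd (lt_trans hz ht) (not_lt.2 (rep_mem z).1)
      simp [this]
    · rw [← liftedCdf_eq_measureReal ν₁ (by simp [ht]), ← liftedCdf_eq_measureReal ν₂ (by simp [ht]), h]
    · rcases le_total t 1 with ht' | ht'
      · rw [← liftedCdf_eq_measureReal ν₁ ⟨ht.le, ht'⟩, ← liftedCdf_eq_measureReal ν₂ ⟨ht.le, ht'⟩, h]
      · have : {z | rep z < t} = Set.univ := Set.eq_univ_of_forall fun z =>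
          lt_of_lt_of_le (rep_mem z).2 ht'
        simp [this]
  have hid : (fun x : ℝ => (x : UnitAddCircle)) ∘ rep = id := funext coe_rep
  have key (ν : Measure UnitAddCircle) : (ν.map rep).map (fun x : ℝ => (x : UnitAddCircle)) = ν := by
    rw [Measure.map_map AddCircle.measurable_mk' measurable_rep, hid, Measure.map_id]
  rw [← key ν₁, ← key ν₂, hmap]

/-- `F s + n = F (s + n)`, so `F t` exceeds `F s + n` exactly when `t` exceeds `s + n`. -/
theorem ceil_map_sub_map (F : CircleDeg1Lift) (hm : StrictMono F) (s t : ℝ) :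
    ⌈F t - F s⌉ = ⌈t - s⌉ := by
  refine eq_of_forall_lt_iff fun n => ?_
  rw [Int.lt_ceil, Int.lt_ceil, lt_sub_iff_add_lt', lt_sub_iff_add_lt', ← F.map_add_int,
    hm.lt_iff_lt]

/-- Pointwise, passing from `t` and `z` to their images changes the count by `⌊F (rep z)⌋`, which
does not depend on `t`. Invariance turns the integral of this identity into the claim. -/
theorem liftedCdf_map (F : CircleDeg1Lift) (hm : StrictMono F) (ν : Measure UnitAddCircle)
    [IsProbabilityMeasure ν] (hν : MeasurePreserving (phaseMap F) ν ν) (t : ℝ) :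
    liftedCdf ν (F t) = liftedCdf ν t + ∫ z, (⌊F (rep z)⌋ : ℝ) ∂ν := by
  have hpt (z : UnitAddCircle) :
      (⌈F t - rep (phaseMap F z)⌉ : ℝ) = ⌈t - rep z⌉ + ⌊F (rep z)⌋ := by
    rw [phaseMap, rep_coe, ← ceil_map_sub_map F hm (rep z) t, sub_sub_eq_add_sub, add_sub_right_comm,
      Int.ceil_add_intCast]
    push_cast; rfl
  have hint : Integrable (fun z => (⌊F (rep z)⌋ : ℝ)) ν := by
    have h₁ := (hν.integrable_comp (integrable_ceil_sub_rep ν (F t)).aestronglyMeasurable).2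
      (integrable_ceil_sub_rep ν (F t))
    refine (h₁.sub (integrable_ceil_sub_rep ν t)).congr (ae_of_all _ fun z => ?_)
    simp [hpt]
  rw [liftedCdf_apply, liftedCdf_apply, ← integral_add (integrable_ceil_sub_rep ν t) hint]
  conv_lhs => rw [← hν.map_eq]
  rw [integral_map hν.measurable.aemeasurable]
  · simp only [hpt]
  · rw [hν.map_eq]; exact (integrable_ceil_sub_rep ν (F t)).aestronglyMeasurable

/-- A semiconjugacy by a degree one lift preserves translation numbers, which identifies the
constant. -/
theorem liftedCdf_map_eq_add_translationNumber (F : CircleDeg1Lift) (hm : StrictMono F)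
    (ν : Measure UnitAddCircle) [IsProbabilityMeasure ν]
    (hν : MeasurePreserving (phaseMap F) ν ν) (t : ℝ) :
    liftedCdf ν (F t) = liftedCdf ν t + F.translationNumber := by
  set c := ∫ z, (⌊F (rep z)⌋ : ℝ) ∂ν with hc
  have h := CircleDeg1Lift.translationNumber_eq_of_semiconj (f := liftedCdf ν) (g₁ := F)
    (g₂ := CircleDeg1Lift.translate (Multiplicative.ofAdd c)) fun t => by
      rw [CircleDeg1Lift.translate_apply, liftedCdf_map F hm ν hν, add_comm]
  rw [CircleDeg1Lift.translationNumber_translate] at h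
  rw [h, liftedCdf_map F hm ν hν]

/-! ### Unique ergodicity -/

theorem invariantProb_unique (F : CircleDeg1Lift) (hm : StrictMono F)
    (hirr : Irrational F.translationNumber) {ν₁ ν₂ : Measure UnitAddCircle}
    (h₁ : IsInvariantProb (phaseMap F) ν₁) (h₂ : IsInvariantProb (phaseMap F) ν₂) : ν₁ = ν₂ := by
  have := h₁.1
  have := h₂.1
  have e₁ := liftedCdf_map_eq_add_translationNumber F hm ν₁ h₁.2
  have e₂ := liftedCdf_map_eq_add_translationNumber F hm ν₂ h₂.2
  refine ext_of_liftedCdf fun t => ?_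
  have l₁ := semiconj_sub_le F _ _ hirr e₁ e₂ 0 t
  have l₂ := semiconj_sub_le F _ _ hirr e₂ e₁ 0 t
  rw [liftedCdf_zero, liftedCdf_zero] at l₁ l₂
  linarith

/-- A lift `h` semiconjugates the rotation by `ρ` to `F`, so it pushes Lebesgue measure to an
`F`-invariant one. Continuity of `h` is not needed: monotonicity makes it measurable. -/
theorem exists_invariantProb (F : CircleDeg1Lift) (hc : Continuous F) (hm : StrictMono F) :
    ∃ μ, IsInvariantProb (phaseMap F) μ := by
  set ρ := F.translationNumber
  set T : CircleDeg1Liftˣ := CircleDeg1Lift.translate (Multiplicative.ofAdd ρ)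
  have hT : Function.Bijective (T : CircleDeg1Lift) :=
    CircleDeg1Lift.isUnit_iff_bijective.1 T.isUnit
  obtain ⟨h, hh⟩ := CircleDeg1Lift.semiconj_of_bijective_of_translationNumber_eq hT
    (bijective_of_continuous_of_strictMono F hc hm)
    (CircleDeg1Lift.translationNumber_translate ρ)
  have hmeas : Measurable (phaseMap h) := measurable_phaseMap h.monotone.measurable
  have hFmeas : Measurable (phaseMap F) := measurable_phaseMap hc.measurable
  have hsemi : phaseMap F ∘ phaseMap h = phaseMap h ∘ fun z => (ρ : UnitAddCircle) + z := by
    funext z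
    obtain ⟨y, rfl⟩ := QuotientAddGroup.mk_surjective z
    change phaseMap F (phaseMap h (y : UnitAddCircle)) =
      phaseMap h ((ρ : UnitAddCircle) + (y : UnitAddCircle))
    rw [← AddCircle.coe_add, phaseMap_coe h.map_add_one, phaseMap_coe h.map_add_one,
      phaseMap_coe F.map_add_one, ← hh y, CircleDeg1Lift.translate_apply]
  have : IsProbabilityMeasure (volume : Measure UnitAddCircle) := ⟨by simp⟩
  refine ⟨volume.map (phaseMap h), Measure.isProbabilityMeasure_map hmeas.aemeasurable,
    hFmeas, ?_⟩
  rw [Measure.map_map hFmeas hmeas, hsemi, ← Measure.map_map hmeas (measurable_const_add _),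
    (measurePreserving_add_left volume (ρ : UnitAddCircle)).map_eq]

theorem existsUnique_invariantProb (F : CircleDeg1Lift) (hc : Continuous F) (hm : StrictMono F)
    (hirr : Irrational F.translationNumber) : ∃! μ, IsInvariantProb (phaseMap F) μ :=
  let ⟨μ, hμ⟩ := exists_invariantProb F hc hm
  ⟨μ, hμ, fun _ hν => invariantProb_unique F hm hirr hν hμ⟩

theorem isInvariantProb_invariantMeasure {φ : UnitAddCircle → UnitAddCircle}
    (h : ∃! μ, IsInvariantProb φ μ) : IsInvariantProb φ (invariantMeasure φ) := by
  rw [invariantMeasure, dif_pos h]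
  exact h.choose_spec.1

/-! ### Continuous dependence of the invariant measure -/

/-- On a compact space uniform convergence is convergence in `C(X, Y)`, where postcomposition is
continuous; `g` need not be uniformly continuous. -/
theorem tendstoUniformly_continuous_comp {X Y Z : Type*} [TopologicalSpace X] [CompactSpace X]
    [UniformSpace Y] [UniformSpace Z] {ι : Type*} {l : Filter ι} {u : ι → X → Y} {u₀ : X → Y}
    (hu : ∀ i, Continuous (u i)) (hu₀ : Continuous u₀) (h : TendstoUniformly u u₀ l)
    {g : Y → Z} (hg : Continuous g) :
    TendstoUniformly (fun i x => g (u i x)) (fun x => g (u₀ x)) l := by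
  have h' : Tendsto (fun i => (⟨u i, hu i⟩ : C(X, Y))) l (𝓝 ⟨u₀, hu₀⟩) :=
    ContinuousMap.tendsto_iff_tendstoUniformly.2 h
  exact ContinuousMap.tendsto_iff_tendstoUniformly.1
    (((ContinuousMap.continuous_postcomp (⟨g, hg⟩ : C(Y, Z))).tendsto _).comp h')

theorem tendsto_integral_sub_of_tendstoUniformly {X ι : Type*} [TopologicalSpace X]
    [CompactSpace X] [MeasurableSpace X] [OpensMeasurableSpace X] {l : Filter ι}
    (P : ι → ProbabilityMeasure X) {u : ι → X → ℝ} {u₀ : X → ℝ}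
    (hu : ∀ i, Continuous (u i)) (hu₀ : Continuous u₀) (h : TendstoUniformly u u₀ l) :
    Tendsto (fun i => ∫ x, u i x ∂(P i : Measure X) - ∫ x, u₀ x ∂(P i : Measure X)) l (𝓝 0) := by
  have hint {v : X → ℝ} (hv : Continuous v) (i : ι) : Integrable v (P i : Measure X) :=
    (BoundedContinuousFunction.mkOfCompact ⟨v, hv⟩).integrable _
  rw [Metric.tendsto_nhds]
  intro ε hε
  filter_upwards [Metric.tendstoUniformly_iff.1 h (ε / 2) (half_pos hε)] with i hi
  rw [dist_zero_right, ← integral_sub (hint (hu i) i) (hint hu₀ i)]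
  refine (norm_integral_le_of_norm_le_const (C := ε / 2) (ae_of_all _ fun x => ?_)).trans_lt ?_
  · rw [← dist_eq_norm, dist_comm]; exact (hi x).le
  · simp [hε]

/-- Uniform limits of continuous maps of a compact space carry limits of invariant measures to
invariant measures, so convergence to a uniquely ergodic map forces weak convergence. -/
theorem tendsto_of_invariantProb {X : Type*} [UniformSpace X] [CompactSpace X] [T2Space X]
    [HasOuterApproxClosed X] [MeasurableSpace X] [BorelSpace X] {ι : Type*} {l : Filter ι}
    {φ : ι → X → X} {φ₀ : X → X} (hφ : ∀ i, Continuous (φ i)) (hφ₀ : Continuous φ₀)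
    (h : TendstoUniformly φ φ₀ l) {P : ι → ProbabilityMeasure X} {P₀ : ProbabilityMeasure X}
    (hP : ∀ i, MeasurePreserving (φ i) (P i : Measure X) (P i))
    (huniq : ∀ Q : ProbabilityMeasure X, MeasurePreserving φ₀ (Q : Measure X) Q → Q = P₀) :
    Tendsto P l (𝓝 P₀) := by
  -- The space of probability measures on `X` is compact, so it suffices to identify the cluster
  -- points.
  refine tendsto_nhds_of_unique_mapClusterPt fun Q hQ => huniq Q ⟨hφ₀.measurable, ?_⟩
  obtain ⟨U, hU, hPU⟩ := mapClusterPt_iff_ultrafilter.1 hQ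
  have hPU := ProbabilityMeasure.tendsto_iff_forall_integral_tendsto.1 hPU
  have := Measure.isProbabilityMeasure_map (μ := (Q : Measure X)) hφ₀.measurable.aemeasurable
  refine ext_of_forall_integral_eq_of_IsFiniteMeasure fun g => ?_
  rw [integral_map hφ₀.measurable.aemeasurable g.continuous.aestronglyMeasurable]
  have h₁ := hPU (g.compContinuous ⟨φ₀, hφ₀⟩)
  have h₂ : Tendsto (fun i => ∫ x, g (φ i x) ∂(P i : Measure X) -
      ∫ x, g (φ₀ x) ∂(P i : Measure X)) U (𝓝 0) :=
    (tendsto_integral_sub_of_tendstoUniformly P (fun i => g.continuous.comp (hφ i))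
      (g.continuous.comp hφ₀)
      (tendstoUniformly_continuous_comp hφ hφ₀ h g.continuous)).mono_left hU
  -- Thus `∫ g ∘ φ i ∂P i` tends to `∫ g ∘ φ₀ ∂Q` along `U`; by invariance it equals `∫ g ∂P i`,
  -- which tends to `∫ g ∂Q`.
  have h₃ := h₂.add h₁
  rw [zero_add] at h₃
  refine tendsto_nhds_unique h₃ ((hPU g).congr fun i => ?_)
  have h₄ : ∫ x, g (φ i x) ∂(P i : Measure X) = ∫ x, g x ∂(P i : Measure X) := by
    conv_rhs => rw [← (hP i).map_eq]
    rw [integral_map (hφ i).measurable.aemeasurable g.continuous.aestronglyMeasurable]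
  simp [h₄]

theorem tendstoUniformly_phaseMap {F : ℕ → CircleDeg1Lift} {F₀ : CircleDeg1Lift}
    (h : TendstoUniformly (fun n => F n) F₀ atTop) :
    TendstoUniformly (fun n => phaseMap (F n)) (phaseMap F₀) atTop := by
  rw [Metric.tendstoUniformly_iff] at h ⊢
  intro ε hε
  filter_upwards [h ε hε] with n hn z
  refine lt_of_le_of_lt ?_ (hn (rep z))
  rw [phaseMap, phaseMap, dist_eq_norm, dist_eq_norm, ← AddCircle.coe_sub]
  exact QuotientAddGroup.norm_mk_le_norm

theorem tendstoUniformly_displacement {F : ℕ → CircleDeg1Lift} {F₀ : CircleDeg1Lift}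
    (h : TendstoUniformly (fun n => F n) F₀ atTop) :
    TendstoUniformly (fun n => displacement (F n)) (displacement F₀) atTop := by
  rw [Metric.tendstoUniformly_iff] at h ⊢
  intro ε hε
  filter_upwards [h ε hε] with n hn z
  simpa [displacement] using hn (rep z)

theorem weaklyConverges_map_displacement {F : ℕ → CircleDeg1Lift} {F₀ : CircleDeg1Lift}
    (hc : ∀ n, Continuous (F n)) (hm : ∀ n, StrictMono (F n))
    (hirr : ∀ n, Irrational (F n).translationNumber)
    (hc₀ : Continuous F₀) (hm₀ : StrictMono F₀) (hirr₀ : Irrational F₀.translationNumber)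
    (h : TendstoUniformly (fun n => F n) F₀ atTop) :
    WeaklyConverges (fun n => (invariantMeasure (phaseMap (F n))).map (displacement (F n)))
      ((invariantMeasure (phaseMap F₀)).map (displacement F₀)) := by
  have hμ n := isInvariantProb_invariantMeasure
    (existsUnique_invariantProb (F n) (hc n) (hm n) (hirr n))
  have hμ₀ := isInvariantProb_invariantMeasure (existsUnique_invariantProb F₀ hc₀ hm₀ hirr₀)
  let P : ℕ → ProbabilityMeasure UnitAddCircle := fun n => ⟨_, (hμ n).1⟩
  let P₀ : ProbabilityMeasure UnitAddCircle := ⟨_, hμ₀.1⟩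
  have hP : Tendsto P atTop (𝓝 P₀) :=
    tendsto_of_invariantProb (fun n => continuous_phaseMap (F n) (hc n))
      (continuous_phaseMap F₀ hc₀) (tendstoUniformly_phaseMap h) (fun n => (hμ n).2)
      fun Q hQ => Subtype.ext (invariantProb_unique F₀ hm₀ hirr₀ ⟨Q.2, hQ⟩ hμ₀)
  intro g
  have hd n := continuous_displacement (F n) (hc n)
  have hd₀ := continuous_displacement F₀ hc₀
  have h₁ := tendsto_integral_sub_of_tendstoUniformly P (fun n => g.continuous.comp (hd n))
    (g.continuous.comp hd₀)
    (tendstoUniformly_continuous_comp hd hd₀ (tendstoUniformly_displacement h) g.continuous)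
  have h₂ := ProbabilityMeasure.tendsto_iff_forall_integral_tendsto.1 hP
    (g.compContinuous ⟨_, hd₀⟩)
  have h₃ := h₁.add h₂
  rw [zero_add] at h₃
  rw [integral_map hd₀.measurable.aemeasurable g.continuous.aestronglyMeasurable]
  refine h₃.congr fun n => ?_
  rw [integral_map (hd n).measurable.aemeasurable g.continuous.aestronglyMeasurable]
  simp [P]


/-! ### The firing map -/

theorem intervalIntegrable_of_memLinftyLoc {σ : ℝ} {f : ℝ → ℝ} (hf : MemLinftyLoc f) (a b : ℝ) :
    IntervalIntegrable (fun u => (f u - σ) * Real.exp (σ * u)) volume a b := by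
  have hfi : IntervalIntegrable f volume a b := by
    rw [intervalIntegrable_iff]
    have : IsFiniteMeasure (volume.restrict (Set.uIcc a b)) :=
      isFiniteMeasure_restrict.2 isCompact_uIcc.measure_lt_top.ne
    have h : IntegrableOn f (Set.uIcc a b) volume :=
      (hf _ isCompact_uIcc).integrable le_top
    exact h.mono_set Set.uIoc_subset_uIcc
  exact (hfi.sub intervalIntegrable_const).mul_continuousOn (by fun_prop)

variable {σ c : ℝ} {f : ℝ → ℝ}

theorem mul_sub_le_integral (hσ : 0 ≤ σ) (hf : MemLinftyLoc f) (hc : 0 ≤ c)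
    (hpos : ∀ᵐ t ∂(volume : Measure ℝ), c ≤ f t - σ) {r s t : ℝ} (hrs : r ≤ s) (hst : s ≤ t) :
    c * Real.exp (σ * r) * (t - s) ≤ ∫ u in s..t, (f u - σ) * Real.exp (σ * u) := by
  have h : ∫ _ in s..t, c * Real.exp (σ * r) ≤ ∫ u in s..t, (f u - σ) * Real.exp (σ * u) := by
    refine intervalIntegral.integral_mono_ae_restrict hst intervalIntegrable_const
      (intervalIntegrable_of_memLinftyLoc hf s t) ?_
    filter_upwards [ae_restrict_of_ae hpos, ae_restrict_mem measurableSet_Icc] with u hu hmem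
    have : Real.exp (σ * r) ≤ Real.exp (σ * u) :=
      Real.exp_le_exp.2 (mul_le_mul_of_nonneg_left (hrs.trans hmem.1) hσ)
    exact mul_le_mul hu this (Real.exp_pos _).le (hc.trans hu)
  rw [intervalIntegral.integral_const, smul_eq_mul] at h
  linarith

theorem strictMono_integral (hσ : 0 ≤ σ) (hf : MemLinftyLoc f) (hc : 0 < c)
    (hpos : ∀ᵐ t ∂(volume : Measure ℝ), c ≤ f t - σ) (a : ℝ) :
    StrictMono fun s => ∫ u in a..s, (f u - σ) * Real.exp (σ * u) := by
  intro s t hst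
  have h := mul_sub_le_integral hσ hf hc.le hpos le_rfl hst.le
  have h' := intervalIntegral.integral_add_adjacent_intervals
    (intervalIntegrable_of_memLinftyLoc (σ := σ) hf a s)
    (intervalIntegrable_of_memLinftyLoc (σ := σ) hf s t)
  have : 0 < c * Real.exp (σ * s) * (t - s) :=
    mul_pos (mul_pos hc (Real.exp_pos _)) (sub_pos.2 hst)
  simp only
  linarith

theorem continuous_integral (hf : MemLinftyLoc f) (a : ℝ) :
    Continuous fun s => ∫ u in a..s, (f u - σ) * Real.exp (σ * u) :=
  intervalIntegral.continuous_primitive (intervalIntegrable_of_memLinftyLoc hf) a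

/-- The integral is strictly increasing in its upper limit, so the set in the infimum is the
half-line `[s, ∞)`. -/
theorem firingMap_eq (hσ : 0 ≤ σ) (hf : MemLinftyLoc f) (hc : 0 < c)
    (hpos : ∀ᵐ t ∂(volume : Measure ℝ), c ≤ f t - σ) {t s : ℝ}
    (h : ∫ u in t..s, (f u - σ) * Real.exp (σ * u) = Real.exp (σ * t)) :
    firingMap σ f t = s := by
  have hmono := strictMono_integral hσ hf hc hpos t
  have hset : {r : ℝ | t < r ∧
      Real.exp (σ * t) ≤ ∫ u in t..r, (f u - σ) * Real.exp (σ * u)} = Set.Ici s := by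
    ext r
    have hts : t < s := hmono.lt_iff_lt.1 (by simp [h, Real.exp_pos])
    refine ⟨fun hr => hmono.le_iff_le.1 (h.trans_le hr.2), fun hr => ⟨hts.trans_le hr, ?_⟩⟩
    exact h.symm.trans_le (hmono.monotone hr)
  rw [firingMap, hset, csInf_Ici]

theorem integral_firingMap (hσ : 0 ≤ σ) (hf : MemLinftyLoc f) (hc : 0 < c)
    (hpos : ∀ᵐ t ∂(volume : Measure ℝ), c ≤ f t - σ) (t : ℝ) :
    ∫ u in t..firingMap σ f t, (f u - σ) * Real.exp (σ * u) = Real.exp (σ * t) := by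
  -- The integral grows at rate at least `c * exp (σ t)`, so it reaches `exp (σ t)` within time `1 /
  -- c`.
  have hle : t ≤ t + 1 / c := by have := one_div_pos.2 hc; linarith
  have hupper : Real.exp (σ * t) ≤ ∫ u in t..(t + 1 / c), (f u - σ) * Real.exp (σ * u) := by
    refine le_trans (le_of_eq ?_) (mul_sub_le_integral hσ hf hc.le hpos le_rfl hle)
    field_simp
    ring
  obtain ⟨s, -, hs⟩ := intermediate_value_Icc hle (continuous_integral (σ := σ) hf t).continuousOn
    ⟨by simp [(Real.exp_pos (σ * t)).le], hupper⟩
  rw [firingMap_eq hσ hf hc hpos hs]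
  exact hs

theorem lt_firingMap (hσ : 0 ≤ σ) (hf : MemLinftyLoc f) (hc : 0 < c)
    (hpos : ∀ᵐ t ∂(volume : Measure ℝ), c ≤ f t - σ) (t : ℝ) : t < firingMap σ f t :=
  (strictMono_integral hσ hf hc hpos t).lt_iff_lt.1
    (by simp [integral_firingMap hσ hf hc hpos, Real.exp_pos])

theorem firingMap_sub_le (hσ : 0 ≤ σ) (hf : MemLinftyLoc f) (hc : 0 < c)
    (hpos : ∀ᵐ t ∂(volume : Measure ℝ), c ≤ f t - σ) (t : ℝ) : firingMap σ f t - t ≤ 1 / c := by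
  have h := mul_sub_le_integral hσ hf hc.le hpos le_rfl (lt_firingMap hσ hf hc hpos t).le
  rw [integral_firingMap hσ hf hc hpos] at h
  rw [le_div_iff₀ hc]
  have he := Real.exp_pos (σ * t)
  by_contra! hlt
  nlinarith

theorem primitive_firingMap (hσ : 0 ≤ σ) (hf : MemLinftyLoc f) (hc : 0 < c)
    (hpos : ∀ᵐ t ∂(volume : Measure ℝ), c ≤ f t - σ) (t : ℝ) :
    ∫ u in (0 : ℝ)..firingMap σ f t, (f u - σ) * Real.exp (σ * u) =
      (∫ u in (0 : ℝ)..t, (f u - σ) * Real.exp (σ * u)) + Real.exp (σ * t) := by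
  rw [← integral_firingMap hσ hf hc hpos t]
  exact (intervalIntegral.integral_add_adjacent_intervals
    (intervalIntegrable_of_memLinftyLoc hf _ _) (intervalIntegrable_of_memLinftyLoc hf _ _)).symm

theorem strictMono_firingMap (hσ : 0 ≤ σ) (hf : MemLinftyLoc f) (hc : 0 < c)
    (hpos : ∀ᵐ t ∂(volume : Measure ℝ), c ≤ f t - σ) : StrictMono (firingMap σ f) := by
  intro s t hst
  have hmono := strictMono_integral hσ hf hc hpos 0
  refine hmono.lt_iff_lt.1 ?_
  simp only [primitive_firingMap hσ hf hc hpos]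
  exact add_lt_add_of_lt_of_le (hmono hst)
    (Real.exp_le_exp.2 (mul_le_mul_of_nonneg_left hst.le hσ))

/-- The primitive is a topological embedding, so continuity can be tested after composing with it,
where `primitive_firingMap` is explicit. -/
theorem continuous_firingMap (hσ : 0 ≤ σ) (hf : MemLinftyLoc f) (hc : 0 < c)
    (hpos : ∀ᵐ t ∂(volume : Measure ℝ), c ≤ f t - σ) : Continuous (firingMap σ f) := by
  have hcont := continuous_integral (σ := σ) hf 0
  have hemb := (strictMono_integral hσ hf hc hpos 0).isEmbedding_of_ordConnected
    (isPreconnected_range hcont).ordConnected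
  refine hemb.continuous_iff.2 ?_
  have : (fun s => ∫ u in (0 : ℝ)..s, (f u - σ) * Real.exp (σ * u)) ∘ firingMap σ f = fun t =>
      (∫ u in (0 : ℝ)..t, (f u - σ) * Real.exp (σ * u)) + Real.exp (σ * t) :=
    funext (primitive_firingMap hσ hf hc hpos)
  rw [this]
  exact hcont.add (by fun_prop)

theorem integral_add_one_add_one (hper : AEPeriodicOne f) (s t : ℝ) :
    ∫ u in (s + 1)..(t + 1), (f u - σ) * Real.exp (σ * u) =
      Real.exp σ * ∫ u in s..t, (f u - σ) * Real.exp (σ * u) := by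
  rw [← intervalIntegral.integral_comp_add_right (fun u => (f u - σ) * Real.exp (σ * u)) 1,
    ← intervalIntegral.integral_const_mul]
  refine intervalIntegral.integral_congr_ae ?_
  filter_upwards [hper] with u hu _
  rw [hu, mul_add, mul_one, Real.exp_add]
  ring

theorem firingMap_add_one (hσ : 0 ≤ σ) (hf : MemLinftyLoc f) (hper : AEPeriodicOne f) (hc : 0 < c)
    (hpos : ∀ᵐ t ∂(volume : Measure ℝ), c ≤ f t - σ) (t : ℝ) :
    firingMap σ f (t + 1) = firingMap σ f t + 1 := by
  refine firingMap_eq hσ hf hc hpos ?_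
  rw [integral_add_one_add_one hper, integral_firingMap hσ hf hc hpos, ← Real.exp_add]
  ring_nf

/-- The firing map as the lift of a degree one circle map. -/
noncomputable def firingLift (hσ : 0 ≤ σ) (hf : MemLinftyLoc f) (hper : AEPeriodicOne f)
    (hc : 0 < c) (hpos : ∀ᵐ t ∂(volume : Measure ℝ), c ≤ f t - σ) : CircleDeg1Lift where
  toFun := firingMap σ f
  monotone' := (strictMono_firingMap hσ hf hc hpos).monotone
  map_add_one' := firingMap_add_one hσ hf hper hc hpos

theorem translationNumber_eq_of_hasRotationNumber (F : CircleDeg1Lift) {ρ : ℝ}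
    (h : HasRotationNumber F ρ) : F.translationNumber = ρ :=
  F.translationNumber_eq_of_tendsto₀ (h 0)

/-- On `[t, s]` the two integrals differ by at most `δ * exp (σ s) * (s - t)`, and the `g`-integral
makes this up between `s` and `r` at rate at least `c * exp (σ t)`. One factor `1 / c` comes from `s
- t ≤ 1 / c`, the other from the rate, and `exp (σ / c)` from `exp (σ (s - t))`, so the bound is
uniform in `t`. -/
theorem abs_firingMap_sub_firingMap_le {g : ℝ → ℝ} {δ : ℝ} (hσ : 0 ≤ σ) (hf : MemLinftyLoc f)
    (hg : MemLinftyLoc g) (hc : 0 < c) (hposf : ∀ᵐ t ∂(volume : Measure ℝ), c ≤ f t - σ)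
    (hposg : ∀ᵐ t ∂(volume : Measure ℝ), c ≤ g t - σ)
    (hδ : ∀ᵐ t ∂(volume : Measure ℝ), |g t - f t| ≤ δ) (t : ℝ) :
    |firingMap σ g t - firingMap σ f t| ≤ δ * (Real.exp (σ / c) / c ^ 2) := by
  obtain ⟨u₀, hu₀⟩ := hδ.exists
  have hδ₀ : 0 ≤ δ := (abs_nonneg _).trans hu₀
  set s := firingMap σ f t with hs
  set r := firingMap σ g t with hr
  have hts : t < s := lt_firingMap hσ hf hc hposf t
  have htr : t < r := lt_firingMap hσ hg hc hposg t
  have hst : s - t ≤ 1 / c := firingMap_sub_le hσ hf hc hposf t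
  have hig (a b : ℝ) := intervalIntegrable_of_memLinftyLoc (σ := σ) hg a b
  have hif (a b : ℝ) := intervalIntegrable_of_memLinftyLoc (σ := σ) hf a b
  have hIs : ∫ u in t..s, (f u - σ) * Real.exp (σ * u) = Real.exp (σ * t) :=
    integral_firingMap hσ hf hc hposf t
  have hIr : ∫ u in t..r, (g u - σ) * Real.exp (σ * u) = Real.exp (σ * t) :=
    integral_firingMap hσ hg hc hposg t
  have hadd := intervalIntegral.integral_add_adjacent_intervals (hig t s) (hig s r)
  have hdiff : |(∫ u in t..s, (g u - σ) * Real.exp (σ * u)) -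
      ∫ u in t..s, (f u - σ) * Real.exp (σ * u)| ≤ δ * Real.exp (σ * s) * (s - t) := by
    rw [← intervalIntegral.integral_sub (hig t s) (hif t s), ← Real.norm_eq_abs]
    have := intervalIntegral.norm_integral_le_of_norm_le_const_ae (a := t) (b := s)
      (C := δ * Real.exp (σ * s))
      (f := fun u => (g u - σ) * Real.exp (σ * u) - (f u - σ) * Real.exp (σ * u)) ?_
    · rwa [abs_of_pos (sub_pos.2 hts)] at this
    · filter_upwards [hδ] with u hu hmem
      rw [Set.uIoc_of_le hts.le] at hmem
      rw [show (g u - σ) * Real.exp (σ * u) - (f u - σ) * Real.exp (σ * u) =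
        (g u - f u) * Real.exp (σ * u) by ring, norm_mul, Real.norm_eq_abs, Real.norm_eq_abs,
        abs_of_pos (Real.exp_pos _)]
      exact mul_le_mul hu (Real.exp_le_exp.2 (mul_le_mul_of_nonneg_left hmem.2 hσ))
        (Real.exp_pos _).le hδ₀
  have hlow : c * Real.exp (σ * t) * |r - s| ≤
      |∫ u in s..r, (g u - σ) * Real.exp (σ * u)| := by
    rcases le_total s r with hsr | hrs
    · rw [abs_of_nonneg (sub_nonneg.2 hsr)]
      exact (mul_sub_le_integral hσ hg hc.le hposg hts.le hsr).trans (le_abs_self _)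
    · rw [abs_sub_comm, abs_of_nonneg (sub_nonneg.2 hrs), intervalIntegral.integral_symm, abs_neg]
      exact (mul_sub_le_integral hσ hg hc.le hposg htr.le hrs).trans (le_abs_self _)
  -- Both integrals, up to `s` for `f` and up to `r` for `g`, equal `exp (σ t)`.
  have heq : |∫ u in s..r, (g u - σ) * Real.exp (σ * u)| =
      |(∫ u in t..s, (g u - σ) * Real.exp (σ * u)) -
        ∫ u in t..s, (f u - σ) * Real.exp (σ * u)| := by
    rw [abs_sub_comm]
    congr 1
    linarith
  have hexp : Real.exp (σ * s) ≤ Real.exp (σ * t) * Real.exp (σ / c) := by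
    rw [← Real.exp_add, Real.exp_le_exp]
    have : σ * (s - t) ≤ σ * (1 / c) := mul_le_mul_of_nonneg_left hst hσ
    rw [mul_one_div] at this
    linarith
  have hbound : c * Real.exp (σ * t) * |r - s| ≤
      δ * (Real.exp (σ * t) * Real.exp (σ / c)) * (1 / c) := by
    refine (hlow.trans_eq heq).trans (hdiff.trans ?_)
    have := sub_nonneg.2 hts.le
    gcongr
  have he := Real.exp_pos (σ * t)
  have hce : 0 < c * Real.exp (σ * t) := mul_pos hc he
  refine le_of_mul_le_mul_left (hbound.trans_eq ?_) hce
  field_simp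


/-! ### Convergence in `L^∞_loc` -/

theorem ae_add_int_eq {h : ℝ → ℝ} (hper : AEPeriodicOne h) :
    ∀ᵐ t ∂(volume : Measure ℝ), ∀ k : ℤ, h (t + k) = h t := by
  have hstep : ∀ᵐ t ∂(volume : Measure ℝ), ∀ k : ℤ, h (t + k + 1) = h (t + k) :=
    ae_all_iff.2 fun k => (measurePreserving_add_right volume (k : ℝ)).quasiMeasurePreserving.ae hper
  filter_upwards [hstep] with t ht k
  induction k using Int.induction_on with
  | zero => simp
  | succ i ih => rw [← ih, ← ht i]; push_cast; ring_nf
  | pred i ih =>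
    rw [← ih, ← ht (-(i : ℤ) - 1)]
    push_cast
    ring_nf

/-- The translate `t - ⌊t⌋` lies in the window, and the countably many integer translates of a null
set are null. -/
theorem ae_of_ae_restrict_Icc {h : ℝ → ℝ} (hper : AEPeriodicOne h) {p : ℝ → Prop}
    (hp : ∀ᵐ t ∂(volume.restrict (Set.Icc (-1 : ℝ) 1)), p (h t)) :
    ∀ᵐ t ∂(volume : Measure ℝ), p (h t) := by
  rw [ae_restrict_iff' measurableSet_Icc] at hp
  have hshift : ∀ᵐ t ∂(volume : Measure ℝ), ∀ k : ℤ,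
      t + (k : ℝ) ∈ Set.Icc (-1 : ℝ) 1 → p (h (t + k)) :=
    ae_all_iff.2 fun k => (measurePreserving_add_right volume (k : ℝ)).quasiMeasurePreserving.ae hp
  filter_upwards [hshift, ae_add_int_eq hper] with t ht hk
  have h₁ := Int.floor_le t
  have h₂ := Int.lt_floor_add_one t
  rw [← hk (-⌊t⌋)]
  exact ht _ ⟨by push_cast; linarith, by push_cast; linarith⟩

theorem essSupSeminorm_nonneg (k : ℕ) (f : ℝ → ℝ) : 0 ≤ essSupSeminorm k f :=
  ENNReal.toReal_nonneg

theorem div_le_linftyLocDist (f g : ℝ → ℝ) :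
    1 / 2 * (essSupSeminorm 1 (fun t => f t - g t) /
      (1 + essSupSeminorm 1 (fun t => f t - g t))) ≤ linftyLocDist f g := by
  have hnn (j : ℕ) := essSupSeminorm_nonneg (j + 1) fun t => f t - g t
  have hterm (j : ℕ) : 0 ≤ (1 / 2 ^ (j + 1)) * (essSupSeminorm (j + 1) (fun t => f t - g t) /
      (1 + essSupSeminorm (j + 1) (fun t => f t - g t))) := by
    have := hnn j
    positivity
  have hsum : Summable fun j : ℕ => (1 / 2 ^ (j + 1)) *
      (essSupSeminorm (j + 1) (fun t => f t - g t) /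
        (1 + essSupSeminorm (j + 1) (fun t => f t - g t))) := by
    refine Summable.of_nonneg_of_le hterm (fun j => ?_) summable_geometric_two
    have h₁ : essSupSeminorm (j + 1) (fun t => f t - g t) /
        (1 + essSupSeminorm (j + 1) (fun t => f t - g t)) ≤ 1 :=
      div_le_one_of_le₀ (by linarith) (by linarith [hnn j])
    have h₂ : (1 : ℝ) / 2 ^ (j + 1) ≤ (1 / 2) ^ j := by
      rw [one_div_pow]
      exact one_div_le_one_div_of_le (by positivity) (pow_le_pow_right₀ one_le_two j.le_succ)
    calc _ ≤ (1 : ℝ) / 2 ^ (j + 1) * 1 := mul_le_mul_of_nonneg_left h₁ (by positivity)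
      _ ≤ _ := by rwa [mul_one]
  have := hsum.le_tsum 0 fun j _ => hterm j
  simpa [linftyLocDist] using this

theorem ae_abs_le_essSupSeminorm {h : ℝ → ℝ} (hh : MemLinftyLoc h) :
    ∀ᵐ t ∂(volume.restrict (Set.Icc (-1 : ℝ) 1)), |h t| ≤ essSupSeminorm 1 h := by
  have hmem := hh _ (isCompact_Icc (a := (-1 : ℝ)) (b := 1))
  have hle := ae_le_eLpNormEssSup (f := h) (μ := volume.restrict (Set.Icc (-1 : ℝ) 1))
  filter_upwards [hle] with t ht
  rw [← eLpNorm_exponent_top] at ht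
  -- Finiteness is essential: `toReal` would send an infinite norm to `0`.
  have := ENNReal.toReal_mono hmem.2.ne ht
  simpa [essSupSeminorm] using this

theorem eventually_ae_abs_sub_le {f : ℝ → ℝ} {fn : ℕ → ℝ → ℝ}
    (hf : MemLinftyLoc f) (hfn : ∀ n, MemLinftyLoc (fn n))
    (hper : AEPeriodicOne f) (hpern : ∀ n, AEPeriodicOne (fn n))
    (hconv : Tendsto (fun n => linftyLocDist (fn n) f) atTop (𝓝 0)) {δ : ℝ} (hδ : 0 < δ) :
    ∀ᶠ n in atTop, ∀ᵐ t ∂(volume : Measure ℝ), |fn n t - f t| ≤ δ := by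
  -- This is the first term of the metric at seminorm `δ`; since `x / (1 + x)` is increasing, a
  -- smaller distance forces a seminorm below `δ`.
  have hpos : 0 < 1 / 2 * (δ / (1 + δ)) := by positivity
  filter_upwards [hconv.eventually_lt_const hpos] with n hn
  have hlt := (div_le_linftyLocDist (fn n) f).trans_lt hn
  have h₀ := essSupSeminorm_nonneg 1 fun t => fn n t - f t
  have hle : essSupSeminorm 1 (fun t => fn n t - f t) ≤ δ := by
    have := lt_of_mul_lt_mul_left hlt (by norm_num)
    rw [div_lt_div_iff₀ (by linarith) (by linarith)] at this
    linarith
  have hperd : AEPeriodicOne fun t => fn n t - f t := by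
    filter_upwards [hper, hpern n] with t h₁ h₂
    rw [h₁, h₂]
  have hmem : MemLinftyLoc fun t => fn n t - f t := fun K hK => (hfn n K hK).sub (hf K hK)
  refine ae_of_ae_restrict_Icc (h := fun t => fn n t - f t) (p := fun x => |x| ≤ δ) hperd ?_
  filter_upwards [ae_abs_le_essSupSeminorm hmem] with t ht
  exact ht.trans hle

theorem weaklyConverges_of_add {ν : ℕ → Measure ℝ} {ν₀ : Measure ℝ} (N : ℕ)
    (h : WeaklyConverges (fun n => ν (n + N)) ν₀) : WeaklyConverges ν ν₀ :=
  fun g => (tendsto_add_atTop_iff_nat N).1 (h g)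

end IntegrateFire

theorem mainTheorem7 (σ : ℝ) (hσ : 0 ≤ σ) (f : ℝ → ℝ) (fn : ℕ → ℝ → ℝ)
    (hf : MemLinftyLoc f) (hfn : ∀ n, MemLinftyLoc (fn n))
    (hper : AEPeriodicOne f) (hpern : ∀ n, AEPeriodicOne (fn n))
    (ς : ℝ) (hς : 0 < ς) (hpos : ∀ᵐ t ∂(volume : Measure ℝ), ς < f t - σ)
    (ρ : ℝ) (hρ : HasRotationNumber (firingMap σ f) ρ) (hρirr : Irrational ρ)
    (ρn : ℕ → ℝ) (hρn : ∀ n, HasRotationNumber (firingMap σ (fn n)) (ρn n))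
    (hρnirr : ∀ n, Irrational (ρn n))
    (hconv : Tendsto (fun n => linftyLocDist (fn n) f) atTop (𝓝 0)) :
    -- the invariant measures are well defined (for `fn n`, as soon as `n` is large)
    (∃! μ, IsInvariantProb (phaseMap (firingMap σ f)) μ) ∧
    (∀ᶠ n in atTop, ∃! μ, IsInvariantProb (phaseMap (firingMap σ (fn n))) μ) ∧
    WeaklyConverges (fun n => isiDistribution σ (fn n)) (isiDistribution σ f) := by
  -- A perturbation of `f` by at most `ς / 2` keeps the lower bound `ς / 2`. For `fn n` this holds
  -- only from some `N` on, hence the shift of indices below.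
  have hc : 0 < ς / 2 := half_pos hς
  have hposf : ∀ᵐ t ∂(volume : Measure ℝ), ς / 2 ≤ f t - σ := by
    filter_upwards [hpos] with t ht
    linarith
  have hclose {δ : ℝ} (hδ : 0 < δ) := eventually_ae_abs_sub_le hf hfn hper hpern hconv hδ
  obtain ⟨N, hN⟩ := eventually_atTop.1 (hclose hc)
  have hposn (n : ℕ) (hn : N ≤ n) : ∀ᵐ t ∂(volume : Measure ℝ), ς / 2 ≤ fn n t - σ := by
    filter_upwards [hpos, hN n hn] with t h₁ h₂
    linarith [(abs_le.1 h₂).1]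
  let F₀ := firingLift hσ hf hper hc hposf
  let F (n : ℕ) := firingLift hσ (hfn (n + N)) (hpern (n + N)) hc (hposn (n + N) (by omega))
  have hirr₀ : Irrational F₀.translationNumber := by
    rwa [translationNumber_eq_of_hasRotationNumber F₀ hρ]
  have hirr (n : ℕ) : Irrational (F n).translationNumber := by
    rw [translationNumber_eq_of_hasRotationNumber (F n) (hρn (n + N))]
    exact hρnirr _
  have hc₀ : Continuous F₀ := continuous_firingMap hσ hf hc hposf
  have hm₀ : StrictMono F₀ := strictMono_firingMap hσ hf hc hposf
  have hcn (n : ℕ) : Continuous (F n) :=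
    continuous_firingMap hσ (hfn _) hc (hposn (n + N) (by omega))
  have hmn (n : ℕ) : StrictMono (F n) :=
    strictMono_firingMap hσ (hfn _) hc (hposn (n + N) (by omega))
  have hunif : TendstoUniformly (fun n => F n) F₀ atTop := by
    rw [Metric.tendstoUniformly_iff]
    intro ε hε
    set K := Real.exp (σ / (ς / 2)) / (ς / 2) ^ 2
    have hK : 0 < K := by positivity
    have hδ : 0 < ε / (2 * K) := by positivity
    filter_upwards [(tendsto_add_atTop_nat N).eventually (hclose hδ)] with n hn t
    rw [dist_comm, Real.dist_eq]
    refine (abs_firingMap_sub_firingMap_le hσ hf (hfn (n + N)) hc hposf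
      (hposn (n + N) (by omega)) hn t).trans_lt ?_
    change ε / (2 * K) * K < ε
    have : ε / (2 * K) * K = ε / 2 := by field_simp
    linarith
  refine ⟨existsUnique_invariantProb F₀ hc₀ hm₀ hirr₀, ?_, weaklyConverges_of_add N
    (weaklyConverges_map_displacement hcn hmn hirr hc₀ hm₀ hirr₀ hunif)⟩
  filter_upwards [eventually_ge_atTop N] with n hn
  obtain ⟨m, rfl⟩ := Nat.exists_eq_add_of_le' hn
  exact existsUnique_invariantProb (F m) (hcn m) (hmn m) (hirr m)
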